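/- Let $0<\kappa<1$, $\lambda=\sqrt{1-\kappa^2}$, and let $k>0$ be given by $k^2=\frac{1-\lambda}{1+\lambda}$. Put $f(T)=\int_0^T {}_2F_1\left(\tfrac14,\tfrac34;\tfrac12;\kappa^2\sin^2 t\right)dt$ for complex $T$ near $0$, let $\phi$ be the analytic inverse of $f$ near $0$ with $\phi(0)=0$, and let $\psi$ be the function analytic near $0$ with $\psi(0)=0$ and $\sin\psi=\kappa\sin\phi$. Then there is exactly one elliptic function on $\mathbb{C}$ that agrees with $\cos\psi$ near $0$; call it $\mathrm{dn}_2$. Likewise there is exactly one meromorphic function on $\mathbb{C}$ that near $0$ agrees with $\sin\circ\mathrm{am}$, where $\mathrm{am}$ is the analytic inverse near $0$, with $\mathrm{am}(0)=0$, of $T\mapsto\int_0^T\frac{d\theta}{\sqrt{1-k^2\sin^2\theta}}$; it is the Jacobi sine $\mathrm{sn}=\mathrm{sn}(\cdot,k)$ of modulus $k$. As meromorphic functions of $z\in\mathbb{C}$, $$\mathrm{dn}_2(z)=1-(1-\lambda)\,\mathrm{sn}^2\!\left(z\sqrt{\tfrac{1+\lambda}{2}}\right);$$ that is, $z$ is a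 pole of $\mathrm{dn}_2$ if and only if $z\sqrt{(1+\lambda)/2}$ is a pole of $\mathrm{sn}$, and the identity holds at every $z$ that is not a pole. -/

import Mathlib

open Filter Topology

noncomputable section

/-- The integral `∫₀ᵀ g(t) dt` of `g` along the straight segment from `0` to `T` in `ℂ`. -/
def integralFromZero (g : ℂ → ℂ) (T : ℂ) : ℂ :=
  ∫ s in (0 : ℝ)..1, T * g ((s : ℂ) * T)

/-- `φ` is an analytic local inverse at `0` of the function `f` with `f 0 = 0`. -/
structure IsAnalyticLocalInverse (f φ : ℂ → ℂ) : Prop where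
  analyticAt : AnalyticAt ℂ φ 0
  map_zero : φ 0 = 0
  right_inv : ∀ᶠ z in 𝓝 (0 : ℂ), f (φ z) = z
  left_inv : ∀ᶠ T in 𝓝 (0 : ℂ), φ (f T) = T

/-- A meromorphic function on the whole plane, represented by a function `ℂ → ℂ` that is
continuous away from its poles and, by convention, takes the value `0` at each pole. -/
def IsMeromorphicOnPlane (f : ℂ → ℂ) : Prop :=
  MeromorphicNFOn f Set.univ

/-- An elliptic function: meromorphic on the plane, with two periods that are linearly
independent over `ℝ`. -/
def IsEllipticFunction (f : ℂ → ℂ) : Prop :=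
  IsMeromorphicOnPlane f ∧
    ∃ ω₁ ω₂ : ℂ, LinearIndependent ℝ ![ω₁, ω₂] ∧ f.Periodic ω₁ ∧ f.Periodic ω₂

/-- The meromorphic function `f` has a pole at `z`. -/
def HasPoleAt (f : ℂ → ℂ) (z : ℂ) : Prop :=
  MeromorphicAt f z ∧ meromorphicOrderAt f z < 0

/-- `f(T) = ∫₀ᵀ F(1/4, 3/4; 1/2; κ² sin² t) dt`, with `F` the Gauss hypergeometric function. -/
def shenIntegral (κ : ℝ) (T : ℂ) : ℂ :=
  integralFromZero (fun t =>
    ordinaryHypergeometric (1 / 4 : ℂ) (3 / 4 : ℂ) (1 / 2 : ℂ)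
      ((κ : ℂ) ^ 2 * Complex.sin t ^ 2)) T

/-- `d` is Shen's function `dn₂` of modulus `κ`: the elliptic function that near `0` is `cos ψ`,
where `sin ψ = κ sin φ`, `ψ(0) = 0`, and `φ` is the local inverse of `shenIntegral κ`. -/
def IsShenDn2 (κ : ℝ) (d : ℂ → ℂ) : Prop :=
  IsEllipticFunction d ∧
    ∃ φ ψ : ℂ → ℂ, IsAnalyticLocalInverse (shenIntegral κ) φ ∧
      AnalyticAt ℂ ψ 0 ∧ ψ 0 = 0 ∧
      (∀ᶠ z in 𝓝 (0 : ℂ), Complex.sin (ψ z) = (κ : ℂ) * Complex.sin (φ z)) ∧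
      (∀ᶠ z in 𝓝 (0 : ℂ), d z = Complex.cos (ψ z))

/-- Shen's elliptic function `dn₂` of modulus `κ`. -/
def shenDn2 (κ : ℝ) : ℂ → ℂ :=
  Classical.epsilon (IsShenDn2 κ)

/-- The incomplete elliptic integral of the first kind `∫₀ᵀ dθ / √(1 - k² sin² θ)`
(principal square root; it is used only for `T` near `0`). -/
def incompleteEllipticIntegral (k : ℝ) (T : ℂ) : ℂ :=
  integralFromZero (fun θ =>
    ((1 - (k : ℂ) ^ 2 * Complex.sin θ ^ 2) ^ (1 / 2 : ℂ))⁻¹) T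

/-- `s` is the Jacobi sine of modulus `k`: the meromorphic function on the plane that near `0` is
the sine of the amplitude, the local inverse of the elliptic integral of the first kind. -/
def IsJacobiSn (k : ℝ) (s : ℂ → ℂ) : Prop :=
  IsMeromorphicOnPlane s ∧
    ∃ am : ℂ → ℂ, IsAnalyticLocalInverse (incompleteEllipticIntegral k) am ∧
      ∀ᶠ z in 𝓝 (0 : ℂ), s z = Complex.sin (am z)

/-- The Jacobi sine function `sn(•, k)` of modulus `k`. -/
def jacobiSn (k : ℝ) : ℂ → ℂ :=
  Classical.epsilon (IsJacobiSn k)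

end

/-!
The germ of `sn` at `0` is determined by the differential equation `s'² = (1 - s²)(1 - m s²)` with
`s(0) = 0` and `s'(0) = 1`, and the duplication formula, which expresses `s(2z)` rationally by
`s(z)` and `s'(z)`, continues it meromorphically from disc to disc. On the real line `sn` is the
displacement of an anharmonic oscillator, so it has a quarter period `K`, about which it is
symmetric; hence it is antiperiodic under `2K`. Jacobi's imaginary transformation turns the
quarter period of the complementary parameter `1 - m` into an imaginary period of `sn²`.

The binomial series gives `F(1/4, 3/4; 1/2; sin² w) = cos (w/2) / cos w`. Inverting `shenIntegral`
therefore means that `sin (ψ/2)`, suitably rescaled in value and argument, solves the differential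
equation of `sn`, and `cos ψ = 1 - 2 sin² (ψ/2)`.
-/

section MeromorphicIdentity

variable {𝕜 E : Type*} [NontriviallyNormedField 𝕜] [NormedAddCommGroup E] [NormedSpace 𝕜 E]
  {f g : 𝕜 → E} {U : Set 𝕜} {x y : 𝕜}

theorem eventuallyEq_nhdsNE_of_meromorphicOn_of_isPreconnected
    (hf : MeromorphicOn f U) (hg : MeromorphicOn g U) (hU : IsPreconnected U)
    (hx : x ∈ U) (hy : y ∈ U) (h : f =ᶠ[𝓝[≠] x] g) : f =ᶠ[𝓝[≠] y] g := by
  have order_eq_top_iff (z : 𝕜) : meromorphicOrderAt (f - g) z = ⊤ ↔ f =ᶠ[𝓝[≠] z] g := by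
    simp only [meromorphicOrderAt_eq_top_iff, EventuallyEq, Pi.sub_apply, sub_eq_zero]
  rw [← order_eq_top_iff] at h ⊢
  by_contra hne
  exact (hf.sub hg).meromorphicOrderAt_ne_top_of_isPreconnected hU hy hx hne h

theorem eventuallyEq_nhds_of_meromorphicNFOn_of_isPreconnected
    (hf : MeromorphicNFOn f U) (hg : MeromorphicNFOn g U) (hU : IsPreconnected U)
    (hx : x ∈ U) (hy : y ∈ U) (h : f =ᶠ[𝓝[≠] x] g) : f =ᶠ[𝓝 y] g :=
  ((hf hy).eventuallyEq_nhdsNE_iff_eventuallyEq_nhds (hg hy)).1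
    (eventuallyEq_nhdsNE_of_meromorphicOn_of_isPreconnected hf.meromorphicOn hg.meromorphicOn
      hU hx hy h)

theorem eventuallyEq_nhdsNE_of_meromorphic [PreconnectedSpace 𝕜]
    (hf : Meromorphic f) (hg : Meromorphic g) (h : f =ᶠ[𝓝[≠] x] g) (y : 𝕜) : f =ᶠ[𝓝[≠] y] g :=
  eventuallyEq_nhdsNE_of_meromorphicOn_of_isPreconnected hf.meromorphicOn hg.meromorphicOn
    isPreconnected_univ (Set.mem_univ x) (Set.mem_univ y) h

theorem eventuallyEq_nhds_of_meromorphic_of_analyticAt [PreconnectedSpace 𝕜]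
    (hf : Meromorphic f) (hg : Meromorphic g) (h : f =ᶠ[𝓝 x] g) (hfy : AnalyticAt 𝕜 f y)
    (hgy : AnalyticAt 𝕜 g y) : f =ᶠ[𝓝 y] g :=
  (hfy.meromorphicNFAt.eventuallyEq_nhdsNE_iff_eventuallyEq_nhds hgy.meromorphicNFAt).1
    (eventuallyEq_nhdsNE_of_meromorphic hf hg (h.filter_mono nhdsWithin_le_nhds) y)

end MeromorphicIdentity

namespace IsMeromorphicOnPlane

variable {f g F : ℂ → ℂ} {z : ℂ}

theorem meromorphicNFAt (hf : IsMeromorphicOnPlane f) (z : ℂ) : MeromorphicNFAt f z :=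
  hf (Set.mem_univ z)

theorem meromorphic (hf : IsMeromorphicOnPlane f) : Meromorphic f :=
  fun z => (hf.meromorphicNFAt z).meromorphicAt

theorem eq_of_eventuallyEq (hf : IsMeromorphicOnPlane f) (hg : IsMeromorphicOnPlane g)
    (h : f =ᶠ[𝓝[≠] z] g) : f = g :=
  funext fun w => (eventuallyEq_nhds_of_meromorphicNFOn_of_isPreconnected hf hg
    isPreconnected_univ (Set.mem_univ z) (Set.mem_univ w) h).eq_of_nhds

theorem neg (hf : IsMeromorphicOnPlane f) : IsMeromorphicOnPlane fun z => -f z := fun z _ => by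
  simpa only [Pi.smul_def', neg_one_smul] using
    (hf.meromorphicNFAt z).smul_analytic (g := fun _ => (-1 : ℂ)) analyticAt_const
      (neg_ne_zero.2 one_ne_zero)

theorem comp_analytic (hf : IsMeromorphicOnPlane f) (hg : ∀ z, AnalyticAt ℂ g z) :
    IsMeromorphicOnPlane fun z => f (g z) :=
  fun z _ => (hf.meromorphicNFAt (g z)).comp_analyticAt (hg z)

theorem periodic_of_eventuallyEq (hf : IsMeromorphicOnPlane f)
    (h : ∀ z, f =ᶠ[𝓝[≠] z] F) {ω : ℂ} (hF : F.Periodic ω) : f.Periodic ω := by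
  have translate : Tendsto (· + ω) (𝓝[≠] (0 : ℂ)) (𝓝[≠] (0 + ω)) :=
    (continuous_add_const ω).continuousAt.continuousWithinAt.tendsto_nhdsWithin
      fun z hz => by simpa using hz
  refine congrFun ((hf.comp_analytic (g := (· + ω)) (by fun_prop)).eq_of_eventuallyEq
    (z := 0) hf ?_)
  filter_upwards [h 0, translate.eventually (h (0 + ω))] with z hz hzω
  rw [hz, hzω, hF]

end IsMeromorphicOnPlane

theorem exists_isMeromorphicOnPlane_of_forall_ball {f : ℂ → ℂ} (hf : AnalyticAt ℂ f 0) {r : ℝ}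
    (hr : 0 < r)
    (h : ∀ n : ℕ, ∃ g, MeromorphicOn g (Metric.ball 0 (2 ^ n * r)) ∧ g =ᶠ[𝓝 0] f) :
    ∃ G, IsMeromorphicOnPlane G ∧ G =ᶠ[𝓝 0] f := by
  choose g g_mero g_eq using h
  set B : ℕ → Set ℂ := fun n => Metric.ball 0 (2 ^ n * r)
  set H : ℕ → ℂ → ℂ := fun n => toMeromorphicNFOn (g n) (B n)
  have zero_mem (n : ℕ) : (0 : ℂ) ∈ B n := Metric.mem_ball_self (by positivity)
  have B_mono {m n : ℕ} (hmn : m ≤ n) : B m ⊆ B n :=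
    Metric.ball_subset_ball (by gcongr; norm_num)
  have B_cover (z : ℂ) : ∃ n, z ∈ B n := by
    obtain ⟨n, hn⟩ := pow_unbounded_of_one_lt (‖z‖ / r) (one_lt_two : (1 : ℝ) < 2)
    exact ⟨n, by simpa [B] using (div_lt_iff₀ hr).1 hn⟩
  have H_nf (n : ℕ) : MeromorphicNFOn (H n) (B n) := meromorphicNFOn_toMeromorphicNFOn _ _
  have H_eq_f (n : ℕ) : H n =ᶠ[𝓝[≠] 0] f :=
    ((g_mero n).toMeromorphicNFOn_eq_self_on_nhdsNE (zero_mem n)).trans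
      ((g_eq n).filter_mono nhdsWithin_le_nhds)
  have H_agree {m n : ℕ} {z : ℂ} (hm : z ∈ B m) (hn : z ∈ B n) : H m z = H n z := by
    wlog hmn : m ≤ n generalizing m n
    · exact (this hn hm (le_of_not_ge hmn)).symm
    exact (eventuallyEq_nhds_of_meromorphicNFOn_of_isPreconnected (H_nf m)
      (fun w hw => H_nf n (B_mono hmn hw)) (convex_ball _ _).isPreconnected (zero_mem m) hm
      ((H_eq_f m).trans (H_eq_f n).symm)).eq_of_nhds
  choose N mem_N using B_cover
  have glued (z : ℂ) : (fun w => H (N w) w) =ᶠ[𝓝 z] H (N z) := by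
    filter_upwards [Metric.isOpen_ball.mem_nhds (mem_N z)] with w hw
    exact H_agree (mem_N w) hw
  refine ⟨fun z => H (N z) z, fun z _ => (meromorphicNFAt_congr (glued z)).2 (H_nf _ (mem_N z)),
    (glued 0).trans ?_⟩
  exact ((H_nf _ (zero_mem _)).eventuallyEq_nhdsNE_iff_eventuallyEq_nhds
    hf.meromorphicNFAt).1 (H_eq_f _)

section HolomorphicODE

variable {E : Type*} [NormedAddCommGroup E] [NormedSpace ℂ E]

theorem eventually_eq_zero_of_norm_deriv_le {h h' : ℂ → E} {z₀ : ℂ} {K : ℝ}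
    (hh : ∀ᶠ z in 𝓝 z₀, HasDerivAt h (h' z) z) (h0 : h z₀ = 0)
    (hK : ∀ᶠ z in 𝓝 z₀, ‖h' z‖ ≤ K * ‖h z‖) : ∀ᶠ z in 𝓝 z₀, h z = 0 := by
  obtain ⟨r, hr, ball⟩ := Metric.eventually_nhds_iff_ball.1 (hh.and hK)
  filter_upwards [Metric.ball_mem_nhds z₀ hr] with z hz
  let γ : ℝ → ℂ := fun t => z₀ + t * (z - z₀)
  have γ_mem (t : ℝ) (ht : t ∈ Set.Icc (0 : ℝ) 1) : γ t ∈ Metric.ball z₀ r :=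
    (convex_ball z₀ r).add_smul_sub_mem (Metric.mem_ball_self hr) hz ht
  have γ_deriv (t : ℝ) : HasDerivAt γ (z - z₀) t := by
    simpa [γ] using Complex.ofRealCLM.hasDerivAt.mul_const (z - z₀)
  have hγ_deriv (t : ℝ) (ht : t ∈ Set.Icc (0 : ℝ) 1) :
      HasDerivAt (h ∘ γ) ((z - z₀) • h' (γ t)) t :=
    (ball _ (γ_mem t ht)).1.scomp t (γ_deriv t)
  have gronwall := eq_zero_of_abs_deriv_le_mul_abs_self_of_eq_zero_right
    (f := h ∘ γ) (K := ‖z - z₀‖ * K) (a := 0) (b := 1)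
    (fun t ht => (hγ_deriv t ht).continuousAt.continuousWithinAt)
    (fun t ht => (hγ_deriv t (Set.Ico_subset_Icc_self ht)).hasDerivWithinAt)
    (by simp [γ, h0]) fun t ht => by
      rw [norm_smul, mul_assoc]
      gcongr
      exact (ball _ (γ_mem t (Set.Ico_subset_Icc_self ht))).2
  simpa [γ] using gronwall 1 (by simp)

theorem eventuallyEq_of_hasDerivAt_of_contDiffAt {v : E → E} {f g : ℂ → E} {z₀ : ℂ}
    (hv : ContDiffAt ℂ 1 v (f z₀)) (hf : ∀ᶠ z in 𝓝 z₀, HasDerivAt f (v (f z)) z)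
    (hg : ∀ᶠ z in 𝓝 z₀, HasDerivAt g (v (g z)) z) (h0 : f z₀ = g z₀) : f =ᶠ[𝓝 z₀] g := by
  obtain ⟨K, t, ht, hK⟩ := hv.exists_lipschitzOnWith
  have difference_eq_zero : ∀ᶠ z in 𝓝 z₀, (f - g) z = 0 := by
    refine eventually_eq_zero_of_norm_deriv_le (K := K) (h' := fun z => v (f z) - v (g z))
      (by filter_upwards [hf, hg] with z hfz hgz using hfz.sub hgz) (by simp [h0]) ?_
    filter_upwards [hf.self_of_nhds.continuousAt.preimage_mem_nhds ht,
      hg.self_of_nhds.continuousAt.preimage_mem_nhds (h0 ▸ ht)] with z hfz hgz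
    exact hK.norm_sub_le hfz hgz
  exact difference_eq_zero.mono fun z hz => sub_eq_zero.1 hz

theorem eventuallyEq_of_hasDerivAt_hasDerivAt {v : E → E} {f f' g g' : ℂ → E} {z₀ : ℂ}
    (hv : ContDiffAt ℂ 1 v (f z₀))
    (hf : ∀ᶠ z in 𝓝 z₀, HasDerivAt f (f' z) z) (hf' : ∀ᶠ z in 𝓝 z₀, HasDerivAt f' (v (f z)) z)
    (hg : ∀ᶠ z in 𝓝 z₀, HasDerivAt g (g' z) z) (hg' : ∀ᶠ z in 𝓝 z₀, HasDerivAt g' (v (g z)) z)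
    (h0 : f z₀ = g z₀) (h0' : f' z₀ = g' z₀) : f =ᶠ[𝓝 z₀] g := by
  have phase_curves_eq : (fun z => (f z, f' z)) =ᶠ[𝓝 z₀] fun z => (g z, g' z) := by
    refine eventuallyEq_of_hasDerivAt_of_contDiffAt (v := fun p : E × E => (p.2, v p.1))
      (contDiffAt_snd.prodMk (hv.comp (f z₀, f' z₀) contDiffAt_fst)) ?_ ?_ (by rw [h0, h0'])
    · filter_upwards [hf, hf'] with z hz hz' using hz.prodMk hz'
    · filter_upwards [hg, hg'] with z hz hz' using hz.prodMk hz'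
  exact phase_curves_eq.mono fun z hz => congrArg Prod.fst hz

end HolomorphicODE

section LocalInverse

variable {f f' g G φ : ℂ → ℂ}

@[simp]
theorem integralFromZero_zero (g : ℂ → ℂ) : integralFromZero g 0 = 0 := by
  simp [integralFromZero]

theorem integralFromZero_eq_sub_of_hasDerivAt {T : ℂ}
    (hG : ∀ w ∈ segment ℝ 0 T, HasDerivAt G (g w) w) (hg : ContinuousOn g (segment ℝ 0 T)) :
    integralFromZero g T = G T - G 0 := by
  have mem_segment (s : ℝ) (hs : s ∈ Set.uIcc (0 : ℝ) 1) : (s : ℂ) * T ∈ segment ℝ 0 T := by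
    rw [Set.uIcc_of_le zero_le_one] at hs
    rw [segment_eq_image]
    exact ⟨s, hs, by simp⟩
  have primitive (s : ℝ) (hs : s ∈ Set.uIcc (0 : ℝ) 1) :
      HasDerivAt (fun s : ℝ => G (s * T)) (T * g (s * T)) s := by
    have line : HasDerivAt (fun s : ℝ => (s : ℂ) * T) T s := by
      simpa using Complex.ofRealCLM.hasDerivAt.mul_const T
    exact (hG _ (mem_segment s hs)).scomp s line
  have integrand_continuousOn : ContinuousOn (fun s : ℝ => T * g (s * T)) (Set.uIcc 0 1) :=
    continuousOn_const.mul (hg.comp (by fun_prop) mem_segment)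
  simpa [integralFromZero] using
    intervalIntegral.integral_eq_sub_of_hasDerivAt primitive
      integrand_continuousOn.intervalIntegrable

theorem eventually_hasDerivAt_integralFromZero (hg : AnalyticAt ℂ g 0) :
    ∀ᶠ T in 𝓝 (0 : ℂ), HasDerivAt (integralFromZero g) (g T) T := by
  obtain ⟨r, hr, g_analytic⟩ := Metric.eventually_nhds_iff_ball.1 hg.eventually_analyticAt
  obtain ⟨G, hG⟩ := DifferentiableOn.isExactOn_ball (f := g) (c := 0) (r := r)
    fun z hz => (g_analytic z hz).differentiableAt.differentiableWithinAt
  have segment_subset {T : ℂ} (hT : T ∈ Metric.ball (0 : ℂ) r) :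
      segment ℝ 0 T ⊆ Metric.ball 0 r :=
    (convex_ball 0 r).segment_subset (Metric.mem_ball_self hr) hT
  filter_upwards [Metric.ball_mem_nhds (0 : ℂ) hr] with T hT
  refine ((hG T hT).sub_const (G 0)).congr_of_eventuallyEq ?_
  filter_upwards [Metric.isOpen_ball.mem_nhds hT] with w hw
  exact integralFromZero_eq_sub_of_hasDerivAt (fun u hu => hG u (segment_subset hw hu))
    fun u hu => (g_analytic u (segment_subset hw hu)).continuousAt.continuousWithinAt

theorem analyticAt_integralFromZero (hg : AnalyticAt ℂ g 0) :
    AnalyticAt ℂ (integralFromZero g) 0 :=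
  Complex.analyticAt_iff_eventually_differentiableAt.2
    ((eventually_hasDerivAt_integralFromZero hg).mono fun _ h => h.differentiableAt)

theorem exists_isAnalyticLocalInverse (hf : AnalyticAt ℂ f 0) (h0 : f 0 = 0)
    (hf' : deriv f 0 ≠ 0) : ∃ φ, IsAnalyticLocalInverse f φ := by
  refine ⟨hf.hasStrictDerivAt.localInverse _ _ _ hf', ?_, ?_, ?_, ?_⟩
  · simpa [h0] using hf.analyticAt_localInverse hf'
  · simpa [h0] using HasStrictFDerivAt.localInverse_apply_image
      (hf.hasStrictDerivAt.hasStrictFDerivAt_equiv hf')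
  · simpa [h0] using hf.hasStrictDerivAt.eventually_right_inverse hf'
  · exact hf.hasStrictDerivAt.eventually_left_inverse hf'

theorem exists_isAnalyticLocalInverse_integralFromZero (hg : AnalyticAt ℂ g 0) (h0 : g 0 ≠ 0) :
    ∃ φ, IsAnalyticLocalInverse (integralFromZero g) φ :=
  exists_isAnalyticLocalInverse (analyticAt_integralFromZero hg) (integralFromZero_zero g)
    (by rwa [(eventually_hasDerivAt_integralFromZero hg).self_of_nhds.deriv])

theorem IsAnalyticLocalInverse.tendsto (h : IsAnalyticLocalInverse f φ) :
    Tendsto φ (𝓝 0) (𝓝 0) := by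
  simpa only [h.map_zero] using h.analyticAt.continuousAt.tendsto

theorem IsAnalyticLocalInverse.eventually_hasDerivAt (h : IsAnalyticLocalInverse f φ)
    (hf : ∀ᶠ T in 𝓝 (0 : ℂ), HasDerivAt f (f' T) T) :
    ∀ᶠ z in 𝓝 (0 : ℂ), HasDerivAt φ (f' (φ z))⁻¹ z := by
  filter_upwards [h.tendsto.eventually hf, h.right_inv.eventually_nhds,
    h.analyticAt.eventually_analyticAt] with z hfz right_inv hφz
  have φ_deriv := hφz.differentiableAt.hasDerivAt
  have chain_rule : f' (φ z) * deriv φ z = 1 :=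
    (hfz.comp z φ_deriv).unique ((hasDerivAt_id z).congr_of_eventuallyEq right_inv)
  rwa [← eq_inv_of_mul_eq_one_right chain_rule]

end LocalInverse

/-- A germ at `0` of the function `sn` of parameter `m = k²`, which may be any complex number:
the solution with `s(0) = 0` and `s'(0) = 1` of `s'² = (1 - s²)(1 - m s²)`. -/
structure IsSnGerm (m : ℂ) (s : ℂ → ℂ) : Prop where
  analyticAt : AnalyticAt ℂ s 0
  map_zero : s 0 = 0
  deriv_zero : deriv s 0 = 1
  sq_deriv : ∀ᶠ z in 𝓝 (0 : ℂ), deriv s z ^ 2 = (1 - s z ^ 2) * (1 - m * s z ^ 2)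

/-- The right-hand side `2 s s' / (1 - m s⁴)` of the duplication formula for `sn`, which expresses
`s(2z)` by `s(z)`. -/
noncomputable def snDouble (m : ℂ) (s : ℂ → ℂ) (z : ℂ) : ℂ :=
  2 * s z * deriv s z / (1 - m * s z ^ 4)

theorem sq_eq_of_duplication {K : Type*} [Field K] {m x y : K}
    (hy : y ^ 2 = (1 - x ^ 2) * (1 - m * x ^ 2)) (hN : 1 - m * x ^ 4 ≠ 0) :
    (((y ^ 2 + x * (2 * m * x ^ 3 - (1 + m) * x)) * (1 - m * x ^ 4) + 4 * m * x ^ 4 * y ^ 2)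
        / (1 - m * x ^ 4) ^ 2) ^ 2
      = (1 - (2 * x * y / (1 - m * x ^ 4)) ^ 2) * (1 - m * (2 * x * y / (1 - m * x ^ 4)) ^ 2) := by
  obtain ⟨N, N_eq⟩ : ∃ N, N = 1 - m * x ^ 4 := ⟨_, rfl⟩
  rw [← N_eq] at hN ⊢
  simp only [div_pow, mul_pow, hy]
  field_simp
  rw [N_eq]
  ring

theorem meromorphicAt_snDouble {m z : ℂ} {s : ℂ → ℂ} (hs : MeromorphicAt s z) :
    MeromorphicAt (snDouble m s) z :=
  (((MeromorphicAt.const 2 z).mul hs).mul hs.deriv).div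
    ((MeromorphicAt.const 1 z).sub ((MeromorphicAt.const m z).mul (hs.pow 4)))

theorem analyticAt_snDouble {m z : ℂ} {s : ℂ → ℂ} (hs : AnalyticAt ℂ s z)
    (hne : 1 - m * s z ^ 4 ≠ 0) : AnalyticAt ℂ (snDouble m s) z :=
  ((analyticAt_const.mul hs).mul hs.deriv).div
    (analyticAt_const.sub (analyticAt_const.mul (hs.pow 4))) hne

namespace IsSnGerm

variable {m : ℂ} {s t : ℂ → ℂ}

theorem of_hasDerivAt {s' : ℂ → ℂ} (hs : ∀ᶠ z in 𝓝 (0 : ℂ), HasDerivAt s (s' z) z)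
    (h0 : s 0 = 0) (h0' : s' 0 = 1)
    (hsq : ∀ᶠ z in 𝓝 (0 : ℂ), s' z ^ 2 = (1 - s z ^ 2) * (1 - m * s z ^ 2)) : IsSnGerm m s where
  analyticAt := Complex.analyticAt_iff_eventually_differentiableAt.2
    (hs.mono fun _ h => h.differentiableAt)
  map_zero := h0
  deriv_zero := by rw [hs.self_of_nhds.deriv, h0']
  sq_deriv := by filter_upwards [hs, hsq] with z hz hz' using by rw [hz.deriv, hz']

theorem congr (h : IsSnGerm m s) (hst : t =ᶠ[𝓝 0] s) : IsSnGerm m t where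
  analyticAt := h.analyticAt.congr hst.symm
  map_zero := by rw [hst.eq_of_nhds, h.map_zero]
  deriv_zero := by rw [hst.deriv_eq, h.deriv_zero]
  sq_deriv := by
    filter_upwards [h.sq_deriv, hst, hst.deriv] with z hz hst hst' using by rw [hst, hst', hz]

theorem eventually_hasDerivAt (h : IsSnGerm m s) :
    ∀ᶠ z in 𝓝 (0 : ℂ), HasDerivAt s (deriv s z) z :=
  h.analyticAt.eventually_analyticAt.mono fun _ hz => hz.differentiableAt.hasDerivAt

theorem eventually_hasDerivAt_deriv (h : IsSnGerm m s) :
    ∀ᶠ z in 𝓝 (0 : ℂ), HasDerivAt (deriv s) (2 * m * s z ^ 3 - (1 + m) * s z) z := by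
  filter_upwards [h.sq_deriv.eventually_nhds, h.eventually_hasDerivAt,
    h.analyticAt.deriv.eventually_analyticAt,
    h.analyticAt.deriv.continuousAt.eventually_ne (h.deriv_zero.trans_ne one_ne_zero)]
    with z hsq hs hs' hne
  have hs'' := hs'.differentiableAt.hasDerivAt
  have differentiated : 2 * deriv s z * deriv (deriv s) z
      = 2 * deriv s z * (2 * m * s z ^ 3 - (1 + m) * s z) := by
    refine Eq.trans (by ring) (((hs''.fun_pow 2).congr_of_eventuallyEq
      (EventuallyEq.symm hsq)).unique (((hs.fun_pow 2).const_sub 1).fun_mul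
        (((hs.fun_pow 2).const_mul m).const_sub 1)) |>.trans ?_)
    push_cast
    ring
  rwa [mul_left_cancel₀ (mul_ne_zero two_ne_zero hne) differentiated] at hs''

theorem eventuallyEq (hs : IsSnGerm m s) (ht : IsSnGerm m t) : s =ᶠ[𝓝 0] t :=
  eventuallyEq_of_hasDerivAt_hasDerivAt (v := fun x => 2 * m * x ^ 3 - (1 + m) * x)
    (by fun_prop) hs.eventually_hasDerivAt hs.eventually_hasDerivAt_deriv
    ht.eventually_hasDerivAt ht.eventually_hasDerivAt_deriv
    (by rw [hs.map_zero, ht.map_zero]) (by rw [hs.deriv_zero, ht.deriv_zero])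

theorem neg_comp_neg (h : IsSnGerm m s) : IsSnGerm m fun z => -s (-z) := by
  have tendsto_neg : Tendsto (fun z : ℂ => -z) (𝓝 0) (𝓝 0) := by simpa using tendsto_neg (0 : ℂ)
  refine of_hasDerivAt (s' := fun z => deriv s (-z)) ?_ (by simp [h.map_zero])
    (by simp [h.deriv_zero]) ?_
  · filter_upwards [tendsto_neg.eventually h.eventually_hasDerivAt] with z hz
    simpa [Function.comp_def] using (hz.scomp z (hasDerivAt_neg z)).fun_neg
  · filter_upwards [tendsto_neg.eventually h.sq_deriv] with z hz
    simpa using hz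

theorem conj_comp_conj (h : IsSnGerm m s) :
    IsSnGerm (starRingEnd ℂ m) fun z => starRingEnd ℂ (s (starRingEnd ℂ z)) := by
  have tendsto_conj : Tendsto (starRingEnd ℂ) (𝓝 0) (𝓝 0) := by
    simpa using Complex.continuous_conj.tendsto 0
  refine of_hasDerivAt (s' := fun z => starRingEnd ℂ (deriv s (starRingEnd ℂ z))) ?_
    (by simp [h.map_zero]) (by simp [h.deriv_zero]) ?_
  · filter_upwards [tendsto_conj.eventually h.eventually_hasDerivAt] with z hz
    simpa [Function.comp_def] using hz.conj_conj
  · filter_upwards [tendsto_conj.eventually h.sq_deriv] with z hz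
    simpa using congrArg (starRingEnd ℂ) hz

theorem duplication (h : IsSnGerm m s) : IsSnGerm m fun z => snDouble m s (z / 2) := by
  have tendsto_half : Tendsto (fun z : ℂ => z / 2) (𝓝 0) (𝓝 0) := by
    simpa using (continuous_id.div_const (2 : ℂ)).tendsto 0
  have eventually_ne : ∀ᶠ z in 𝓝 (0 : ℂ), 1 - m * s z ^ 4 ≠ 0 := by
    have s_continuousAt := h.analyticAt.continuousAt
    exact ContinuousAt.eventually_ne (g := fun z => 1 - m * s z ^ 4) (by fun_prop)
      (by simp [h.map_zero])
  refine of_hasDerivAt (s' := fun z =>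
      ((deriv s (z / 2) ^ 2 + s (z / 2) * (2 * m * s (z / 2) ^ 3 - (1 + m) * s (z / 2)))
          * (1 - m * s (z / 2) ^ 4)
        + 4 * m * s (z / 2) ^ 4 * deriv s (z / 2) ^ 2) / (1 - m * s (z / 2) ^ 4) ^ 2)
    ?_ (by simp [snDouble, h.map_zero]) (by simp [h.map_zero, h.deriv_zero]) ?_
  · filter_upwards [tendsto_half.eventually h.eventually_hasDerivAt,
      tendsto_half.eventually h.eventually_hasDerivAt_deriv,
      tendsto_half.eventually eventually_ne] with z hs hs' hne
    have snDouble_deriv := ((hs.const_mul 2).fun_mul hs').fun_div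
      (((hs.fun_pow 4).const_mul m).const_sub 1) hne
    refine (snDouble_deriv.comp z ((hasDerivAt_id z).div_const 2)).congr_deriv ?_
    push_cast
    field_simp
    ring
  · filter_upwards [tendsto_half.eventually h.sq_deriv, tendsto_half.eventually eventually_ne]
      with z hsq hne
    exact sq_eq_of_duplication hsq hne

theorem exists_isMeromorphicOnPlane (h : IsSnGerm m s) :
    ∃ S, IsMeromorphicOnPlane S ∧ S =ᶠ[𝓝 0] s := by
  obtain ⟨r, hr, s_analytic⟩ :=
    Metric.eventually_nhds_iff_ball.1 h.analyticAt.eventually_analyticAt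
  refine exists_isMeromorphicOnPlane_of_forall_ball h.analyticAt hr fun n => ?_
  induction n with
  | zero => exact ⟨s, fun z hz => (s_analytic z (by simpa using hz)).meromorphicAt, .rfl⟩
  | succ n ih =>
    obtain ⟨g, g_mero, g_eq⟩ := ih
    refine ⟨fun z => snDouble m g (z / 2), fun z hz => ?_,
      (h.congr g_eq).duplication.eventuallyEq h⟩
    have half_mem : z / 2 ∈ Metric.ball (0 : ℂ) (2 ^ n * r) := by
      rw [mem_ball_zero_iff, pow_succ] at hz
      rw [mem_ball_zero_iff, norm_div, Complex.norm_ofNat]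
      linarith
    exact (meromorphicAt_snDouble (g_mero _ half_mem)).comp_analyticAt (g := (· / 2))
      (by fun_prop)

theorem odd (h : IsSnGerm m s) (hs : IsMeromorphicOnPlane s) (z : ℂ) : s (-z) = -s z := by
  have s_eq : (fun z => -s (-z)) = s :=
    (hs.comp_analytic (g := fun z => -z) (by fun_prop)).neg.eq_of_eventuallyEq (z := 0) hs
      ((h.neg_comp_neg.eventuallyEq h).filter_mono nhdsWithin_le_nhds)
  rw [← congrFun s_eq z, neg_neg]

theorem sq_deriv_of_analyticAt (h : IsSnGerm m s) (hs : IsMeromorphicOnPlane s) {z : ℂ}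
    (hz : AnalyticAt ℂ s z) : deriv s z ^ 2 = (1 - s z ^ 2) * (1 - m * s z ^ 2) := by
  have s_mero := hs.meromorphic
  exact (eventuallyEq_nhds_of_meromorphic_of_analyticAt (by fun_prop) (by fun_prop)
    h.sq_deriv (hz.deriv.fun_pow 2) (by fun_prop)).eq_of_nhds

theorem hasDerivAt_deriv_of_analyticAt (h : IsSnGerm m s) (hs : IsMeromorphicOnPlane s) {z : ℂ}
    (hz : AnalyticAt ℂ s z) : HasDerivAt (deriv s) (2 * m * s z ^ 3 - (1 + m) * s z) z := by
  have s_mero := hs.meromorphic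
  have second_deriv : deriv (deriv s) =ᶠ[𝓝 0] fun z => 2 * m * s z ^ 3 - (1 + m) * s z :=
    h.eventually_hasDerivAt_deriv.mono fun _ hw => hw.deriv
  rw [← (eventuallyEq_nhds_of_meromorphic_of_analyticAt (by fun_prop) (by fun_prop)
    second_deriv hz.deriv.deriv (by fun_prop)).eq_of_nhds]
  exact hz.deriv.differentiableAt.hasDerivAt

theorem eventuallyEq_reflect (h : IsSnGerm m s) (hs : IsMeromorphicOnPlane s) {K : ℂ}
    (hK : AnalyticAt ℂ s K) (hK' : deriv s K = 0) :
    (fun z => s (K + z)) =ᶠ[𝓝 0] fun z => s (K - z) := by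
  have tendsto_add : Tendsto (fun z : ℂ => K + z) (𝓝 0) (𝓝 K) := by
    simpa using (continuous_const_add K).tendsto 0
  have tendsto_sub : Tendsto (fun z : ℂ => K - z) (𝓝 0) (𝓝 K) := by
    simpa using (continuous_sub_left K).tendsto 0
  have near_K := hK.eventually_analyticAt
  refine eventuallyEq_of_hasDerivAt_hasDerivAt (v := fun x => 2 * m * x ^ 3 - (1 + m) * x)
    (f' := fun z => deriv s (K + z)) (g' := fun z => -deriv s (K - z)) (by fun_prop)
    ?_ ?_ ?_ ?_ (by simp) (by simp [hK'])
  · filter_upwards [tendsto_add.eventually near_K] with z hz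
    exact hz.differentiableAt.hasDerivAt.comp_const_add K z
  · filter_upwards [tendsto_add.eventually near_K] with z hz
    exact (h.hasDerivAt_deriv_of_analyticAt hs hz).comp_const_add K z
  · filter_upwards [tendsto_sub.eventually near_K] with z hz
    exact hz.differentiableAt.hasDerivAt.comp_const_sub K z
  · filter_upwards [tendsto_sub.eventually near_K] with z hz
    simpa using ((h.hasDerivAt_deriv_of_analyticAt hs hz).comp_const_sub K z).fun_neg

theorem antiperiodic_two_mul (h : IsSnGerm m s) (hs : IsMeromorphicOnPlane s) {K : ℂ}
    (hK : AnalyticAt ℂ s K) (hK' : deriv s K = 0) : s.Antiperiodic (2 * K) := by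
  have reflect : (fun z => s (K + z)) = fun z => s (K - z) :=
    (hs.comp_analytic (g := (K + ·)) (by fun_prop)).eq_of_eventuallyEq (z := 0)
      (hs.comp_analytic (g := (K - ·)) (by fun_prop))
      ((h.eventuallyEq_reflect hs hK hK').filter_mono nhdsWithin_le_nhds)
  intro z
  calc s (z + 2 * K) = s (K + (z + K)) := by ring_nf
    _ = s (K - (z + K)) := congrFun reflect (z + K)
    _ = s (-z) := by ring_nf
    _ = -s z := h.odd hs z

theorem analyticAt_two_mul (h : IsSnGerm m s) (hs : IsMeromorphicOnPlane s) {z : ℂ}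
    (hz : AnalyticAt ℂ s z) (hne : 1 - m * s z ^ 4 ≠ 0) :
    AnalyticAt ℂ s (2 * z) ∧ s (2 * z) = snDouble m s z := by
  have s_mero := hs.meromorphic
  have double_mero : Meromorphic fun w => snDouble m s (w / 2) := fun w =>
    (meromorphicAt_snDouble (s_mero (w / 2))).comp_analyticAt (g := (· / 2)) (by fun_prop)
  have double_analytic : AnalyticAt ℂ (fun w => snDouble m s (w / 2)) (2 * z) :=
    AnalyticAt.fun_comp_of_eq (f := (· / 2)) (analyticAt_snDouble hz hne) (by fun_prop) (by simp)
  have continued : (fun w => snDouble m s (w / 2)) =ᶠ[𝓝 (2 * z)] s :=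
    (double_analytic.meromorphicNFAt.eventuallyEq_nhdsNE_iff_eventuallyEq_nhds
      (hs.meromorphicNFAt _)).1 (eventuallyEq_nhdsNE_of_meromorphic double_mero s_mero
        ((h.duplication.eventuallyEq h).filter_mono nhdsWithin_le_nhds) _)
  exact ⟨double_analytic.congr continued, by simpa using continued.eq_of_nhds.symm⟩

end IsSnGerm

theorem exists_nonpos_of_hasDerivAt_le_neg {f f' : ℝ → ℝ} {a δ : ℝ} (hδ : 0 < δ)
    (hf : ∀ x, HasDerivAt f (f' x) x) (hf' : ∀ x ≥ a, f' x ≤ -δ) : ∃ x ≥ a, f x ≤ 0 := by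
  set b := a + |f a| / δ
  have hab : a ≤ b := le_add_of_nonneg_right (by positivity)
  refine ⟨b, hab, ?_⟩
  have mean_value : f b - f a ≤ -δ * (b - a) :=
    (convex_Ici a).image_sub_le_mul_sub_of_deriv_le
      (fun x _ => (hf x).continuousAt.continuousWithinAt)
      (fun x _ => (hf x).differentiableAt.differentiableWithinAt)
      (fun x hx => (hf x).deriv.trans_le (hf' x (interior_subset hx)))
      a Set.self_mem_Ici b hab hab
  have drop_eq : δ * (b - a) = |f a| := by simp only [b]; field_simp; ring
  linarith [le_abs_self (f a)]

/-- A quarter of an oscillation is completed in finite time since the restoring force stays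
bounded away from zero once `S` has left `0`. -/
theorem exists_pos_eq_zero_of_sq_eq {m : ℝ} (hm0 : 0 ≤ m) (hm1 : m < 1) {S T : ℝ → ℝ}
    (hS : ∀ x, HasDerivAt S (T x) x)
    (hT : ∀ x, HasDerivAt T (2 * m * S x ^ 3 - (1 + m) * S x) x)
    (hsq : ∀ x, T x ^ 2 = (1 - S x ^ 2) * (1 - m * S x ^ 2)) (hS0 : S 0 = 0) (hT0 : 0 < T 0) :
    ∃ K > 0, T K = 0 := by
  have S_cont : Continuous S := continuous_iff_continuousAt.2 fun x => (hS x).continuousAt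
  have T_cont : Continuous T := continuous_iff_continuousAt.2 fun x => (hT x).continuousAt
  suffices ∃ x ≥ 0, T x ≤ 0 by
    obtain ⟨x, hx, hTx⟩ := this
    obtain ⟨K, hK, hTK⟩ := intermediate_value_Icc' hx T_cont.continuousOn ⟨hTx, hT0.le⟩
    exact ⟨K, hK.1.lt_of_ne (by rintro rfl; exact hT0.ne' hTK), hTK⟩
  by_contra! T_pos
  have S_strictMono : StrictMonoOn S (Set.Ici 0) :=
    strictMonoOn_of_deriv_pos (convex_Ici 0) S_cont.continuousOn fun x hx => by
      rw [(hS x).deriv]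
      exact T_pos x (interior_subset hx)
  have S_one_pos : 0 < S 1 :=
    hS0 ▸ S_strictMono Set.self_mem_Ici (Set.mem_Ici.2 zero_le_one) zero_lt_one
  have S_lt_one : ∀ x ≥ 0, S x < 1 := by
    intro x hx
    by_contra! hSx
    obtain ⟨y, hy, hSy⟩ := intermediate_value_Icc hx S_cont.continuousOn
      ⟨hS0.trans_le zero_le_one, hSx⟩
    have := hsq y
    rw [hSy] at this
    nlinarith [T_pos y hy.1]
  have force_le : ∀ x ≥ 1, 2 * m * S x ^ 3 - (1 + m) * S x ≤ -(S 1 * (1 - m)) := by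
    intro x hx
    have hx0 : 0 ≤ x := zero_le_one.trans hx
    have S_one_le : S 1 ≤ S x := S_strictMono.monotoneOn (Set.mem_Ici.2 zero_le_one) hx0 hx
    have stiffness_ge : 1 - m ≤ 1 + m - 2 * m * S x ^ 2 := by
      have : S x ^ 2 ≤ 1 := pow_le_one₀ (S_one_pos.le.trans S_one_le) (S_lt_one x hx0).le
      nlinarith
    calc 2 * m * S x ^ 3 - (1 + m) * S x = -(S x * (1 + m - 2 * m * S x ^ 2)) := by ring
      _ ≤ -(S 1 * (1 - m)) := by gcongr; linarith
  obtain ⟨x, hx, hTx⟩ := exists_nonpos_of_hasDerivAt_le_neg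
    (mul_pos S_one_pos (sub_pos.2 hm1)) hT force_le
  exact (T_pos x (zero_le_one.trans hx)).not_ge hTx

theorem one_sub_mul_pow_four_ne_zero {m x y : ℝ} (hm : m ≠ 1)
    (hy : y ^ 2 = (1 - x ^ 2) * (1 - m * x ^ 2)) : 1 - m * x ^ 4 ≠ 0 := by
  intro h
  have sum_sq_eq : (x * y) ^ 2 + (1 - x ^ 2) ^ 2 = 0 := by
    linear_combination x ^ 2 * hy + (1 - x ^ 2) * h
  have x_sq : x ^ 2 = 1 := by nlinarith [sq_nonneg (x * y), sq_nonneg (1 - x ^ 2)]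
  exact hm (by linear_combination -h - m * (x ^ 2 + 1) * x_sq)

theorem im_eq_zero_of_hasDerivAt {f : ℂ → ℂ} {f' : ℂ} {x : ℝ} (hf : HasDerivAt f f' x)
    (him : ∀ᶠ y : ℝ in 𝓝 x, (f y).im = 0) : f'.im = 0 :=
  (Complex.imCLM.hasFDerivAt.comp_hasDerivAt x hf.comp_ofReal).unique
    ((hasDerivAt_const x (0 : ℝ)).congr_of_eventuallyEq him)

namespace IsSnGerm

variable {m : ℝ} {s : ℂ → ℂ}

theorem eventually_im_eq_zero (h : IsSnGerm m s) : ∀ᶠ x : ℝ in 𝓝 0, (s x).im = 0 := by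
  have conj_germ : IsSnGerm m fun z => starRingEnd ℂ (s (starRingEnd ℂ z)) := by
    simpa only [Complex.conj_ofReal] using h.conj_comp_conj
  filter_upwards [(Complex.continuous_ofReal.tendsto' 0 0 Complex.ofReal_zero).eventually
    (conj_germ.eventuallyEq h)] with x hx
  rwa [Complex.conj_ofReal, Complex.conj_eq_iff_im] at hx

theorem analyticAt_two_mul_ofReal (hm : m ≠ 1) (h : IsSnGerm m s) (hs : IsMeromorphicOnPlane s)
    {x : ℝ} (hx : AnalyticAt ℂ s x) (him : ∀ᶠ y : ℝ in 𝓝 x, (s y).im = 0) :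
    AnalyticAt ℂ s (2 * x) ∧ (s (2 * x)).im = 0 := by
  obtain ⟨a, ha⟩ : ∃ a : ℝ, s x = a := ⟨(s x).re, Complex.ext rfl him.self_of_nhds⟩
  obtain ⟨b, hb⟩ : ∃ b : ℝ, deriv s x = b :=
    ⟨(deriv s x).re, Complex.ext rfl
      (im_eq_zero_of_hasDerivAt hx.differentiableAt.hasDerivAt him)⟩
  have hsq : b ^ 2 = (1 - a ^ 2) * (1 - m * a ^ 2) := by
    have := h.sq_deriv_of_analyticAt hs hx
    rw [ha, hb] at this
    exact_mod_cast this
  have hne : 1 - (m : ℂ) * s x ^ 4 ≠ 0 := by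
    rw [ha]
    exact_mod_cast one_sub_mul_pow_four_ne_zero hm hsq
  obtain ⟨double_analytic, double_eq⟩ := h.analyticAt_two_mul hs hx hne
  refine ⟨double_analytic, ?_⟩
  rw [double_eq, snDouble, ha, hb]
  norm_cast

theorem analyticAt_ofReal (hm : m ≠ 1) (h : IsSnGerm m s) (hs : IsMeromorphicOnPlane s) (x : ℝ) :
    AnalyticAt ℂ s x ∧ (s x).im = 0 := by
  obtain ⟨r, hr, near_zero⟩ := Metric.eventually_nhds_iff_ball.1
    (((Complex.continuous_ofReal.tendsto' 0 0 Complex.ofReal_zero).eventually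
      h.analyticAt.eventually_analyticAt).and h.eventually_im_eq_zero)
  have on_ball (n : ℕ) :
      ∀ x ∈ Metric.ball (0 : ℝ) (2 ^ n * r), AnalyticAt ℂ s x ∧ (s x).im = 0 := by
    induction n with
    | zero => simpa using near_zero
    | succ n ih =>
      intro x hx
      have half_mem : x / 2 ∈ Metric.ball (0 : ℝ) (2 ^ n * r) := by
        rw [mem_ball_zero_iff, pow_succ] at hx
        rw [mem_ball_zero_iff, norm_div, Real.norm_ofNat]
        linarith
      have im_eq_zero := eventually_of_mem (Metric.isOpen_ball.mem_nhds half_mem)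
        fun y hy => (ih y hy).2
      simpa [mul_div_cancel₀] using
        h.analyticAt_two_mul_ofReal hm hs (ih _ half_mem).1 im_eq_zero
  obtain ⟨n, hn⟩ := pow_unbounded_of_one_lt (|x| / r) (one_lt_two : (1 : ℝ) < 2)
  exact on_ball n x (by simpa using (div_lt_iff₀ hr).1 hn)

theorem exists_antiperiodic (hm0 : 0 ≤ m) (hm1 : m < 1) (h : IsSnGerm m s)
    (hs : IsMeromorphicOnPlane s) : ∃ L : ℝ, 0 < L ∧ s.Antiperiodic L := by
  have real_line (x : ℝ) := h.analyticAt_ofReal hm1.ne hs x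
  have s_deriv (x : ℝ) : HasDerivAt s (deriv s x) x := (real_line x).1.differentiableAt.hasDerivAt
  have s_eq (x : ℝ) : s x = (s x).re := Complex.ext rfl (real_line x).2
  have s'_eq (x : ℝ) : deriv s x = (deriv s x).re :=
    Complex.ext rfl (im_eq_zero_of_hasDerivAt (s_deriv x) (.of_forall fun y => (real_line y).2))
  obtain ⟨K, K_pos, hK⟩ := exists_pos_eq_zero_of_sq_eq hm0 hm1
    (S := fun x => (s x).re) (T := fun x => (deriv s x).re)
    (fun x => (s_deriv x).real_of_complex)
    (fun x => by
      have := h.hasDerivAt_deriv_of_analyticAt hs (real_line x).1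
      rw [s_eq] at this
      exact_mod_cast this.real_of_complex)
    (fun x => by
      have := h.sq_deriv_of_analyticAt hs (real_line x).1
      rw [s_eq, s'_eq] at this
      exact_mod_cast this)
    (by simp [h.map_zero]) (by simp [h.deriv_zero])
  refine ⟨2 * K, by positivity, ?_⟩
  simpa using h.antiperiodic_two_mul hs (real_line K).1 (by rw [s'_eq, hK, Complex.ofReal_zero])

end IsSnGerm

theorem cpow_half_ne_zero {z : ℂ} (hz : z ≠ 0) : z ^ (1 / 2 : ℂ) ≠ 0 := by
  simp [Complex.cpow_eq_zero_iff, hz]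

theorem hasDerivAt_cpow_half {u : ℂ → ℂ} {u' z : ℂ} (hu : HasDerivAt u u' z)
    (hz : u z ∈ Complex.slitPlane) :
    HasDerivAt (fun z => u z ^ (1 / 2 : ℂ)) (u' / (2 * u z ^ (1 / 2 : ℂ))) z := by
  have sqrt_ne := cpow_half_ne_zero (Complex.slitPlane_ne_zero hz)
  refine (hu.cpow_const (c := 1 / 2) hz).congr_deriv ?_
  rw [show (1 / 2 - 1 : ℂ) = -(1 / 2) by norm_num, Complex.cpow_neg]
  field_simp

theorem sq_cpow_half (z : ℂ) : (z ^ (1 / 2 : ℂ)) ^ 2 = z := by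
  simp

namespace IsSnGerm

variable {m m' : ℂ} {s s' : ℂ → ℂ}

theorem eventually_one_sub_sq_mem_slitPlane (h : IsSnGerm m s) :
    ∀ᶠ z in 𝓝 (0 : ℂ), 1 - s z ^ 2 ∈ Complex.slitPlane := by
  have s_continuousAt := h.analyticAt.continuousAt
  have : ContinuousAt (fun z => 1 - s z ^ 2) 0 := by fun_prop
  exact this.preimage_mem_nhds (Complex.isOpen_slitPlane.mem_nhds (by simp [h.map_zero]))

theorem imaginary (h : IsSnGerm m s) (hm : m' + m = 1) :
    IsSnGerm m' fun z =>
      Complex.I * (s (-Complex.I * z) / (1 - s (-Complex.I * z) ^ 2) ^ (1 / 2 : ℂ)) := by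
  have tendsto_rotate : Tendsto (fun z : ℂ => -Complex.I * z) (𝓝 0) (𝓝 0) := by
    simpa using (continuous_const_mul (-Complex.I)).tendsto 0
  refine of_hasDerivAt (s' := fun z =>
      deriv s (-Complex.I * z) / ((1 - s (-Complex.I * z) ^ 2) ^ (1 / 2 : ℂ)) ^ 3)
    ?_ (by simp [h.map_zero]) (by simp [h.map_zero, h.deriv_zero]) ?_
  · filter_upwards [tendsto_rotate.eventually h.eventually_hasDerivAt,
      tendsto_rotate.eventually h.eventually_one_sub_sq_mem_slitPlane] with z hs hz
    have w_sq := sq_cpow_half (1 - s (-Complex.I * z) ^ 2)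
    have w_ne := cpow_half_ne_zero (Complex.slitPlane_ne_zero hz)
    have quotient_deriv :=
      hs.fun_div (hasDerivAt_cpow_half ((hs.fun_pow 2).const_sub 1) hz) w_ne
    refine ((quotient_deriv.comp z ((hasDerivAt_id z).const_mul (-Complex.I))).const_mul
      Complex.I).congr_deriv ?_
    generalize (1 - s (-Complex.I * z) ^ 2) ^ (1 / 2 : ℂ) = w at *
    generalize s (-Complex.I * z) = x, deriv s (-Complex.I * z) = y at *
    field_simp
    rw [Complex.I_sq]
    push_cast
    linear_combination 2 * y * w_sq
  · filter_upwards [tendsto_rotate.eventually h.sq_deriv,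
      tendsto_rotate.eventually h.eventually_one_sub_sq_mem_slitPlane] with z hsq hz
    have w_sq := sq_cpow_half (1 - s (-Complex.I * z) ^ 2)
    have w_ne := cpow_half_ne_zero (Complex.slitPlane_ne_zero hz)
    obtain rfl : m' = 1 - m := eq_sub_of_add_eq hm
    rw [div_pow, hsq, mul_pow, Complex.I_sq, div_pow]
    generalize (1 - s (-Complex.I * z) ^ 2) ^ (1 / 2 : ℂ) = w at *
    have x_sq : s (-Complex.I * z) ^ 2 = 1 - w ^ 2 := by rw [w_sq]; ring
    rw [x_sq]
    field_simp
    ring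

theorem periodic_sq_of_imaginary (h : IsSnGerm m s) (hs : IsMeromorphicOnPlane s)
    (h' : IsSnGerm m' s') (hs' : IsMeromorphicOnPlane s') (hm : m + m' = 1) {L : ℂ}
    (hL : s'.Antiperiodic L) : Function.Periodic (fun z => s z ^ 2) (Complex.I * L) := by
  have sq_plane : IsMeromorphicOnPlane fun z => s z ^ 2 := by
    exact_mod_cast hs.zpow (n := 2)
  set F : ℂ → ℂ := fun z => -(s' (-Complex.I * z) ^ 2 / (1 - s' (-Complex.I * z) ^ 2)) with F_eq
  have F_mero : Meromorphic F := by
    have rotated_mero : Meromorphic fun z => s' (-Complex.I * z) :=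
      (hs'.comp_analytic (g := (-Complex.I * ·)) (by fun_prop)).meromorphic
    exact fun z => (((rotated_mero z).pow 2).div
      ((MeromorphicAt.const 1 z).sub ((rotated_mero z).pow 2))).neg
  have F_periodic : F.Periodic (Complex.I * L) := by
    intro z
    have rotated : -Complex.I * (z + Complex.I * L) = -Complex.I * z + L := by
      linear_combination (-L) * Complex.I_sq
    simp only [F_eq, rotated, hL _, neg_sq]
  have sq_eq : (fun z => s z ^ 2) =ᶠ[𝓝[≠] 0] F := by
    filter_upwards [(h.eventuallyEq (h'.imaginary hm)).filter_mono nhdsWithin_le_nhds] with z hz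
    rw [hz, mul_pow, div_pow, Complex.I_sq, sq_cpow_half, neg_one_mul]
  exact sq_plane.periodic_of_eventuallyEq
    (eventuallyEq_nhdsNE_of_meromorphic sq_plane.meromorphic F_mero sq_eq) F_periodic

theorem exists_periods_sq {m : ℝ} (hm0 : 0 < m) (hm1 : m < 1) {s s' : ℂ → ℂ}
    (h : IsSnGerm m s) (h' : IsSnGerm (1 - m : ℝ) s') (hs : IsMeromorphicOnPlane s) :
    ∃ L L' : ℝ, 0 < L ∧ 0 < L' ∧ Function.Periodic (fun z => s z ^ 2) L ∧
      Function.Periodic (fun z => s z ^ 2) (Complex.I * L') := by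
  obtain ⟨S', hS', S'_eq⟩ := h'.exists_isMeromorphicOnPlane
  obtain ⟨L, L_pos, hL⟩ := h.exists_antiperiodic hm0.le hm1 hs
  obtain ⟨L', L'_pos, hL'⟩ := (h'.congr S'_eq).exists_antiperiodic
    (sub_nonneg.2 hm1.le) (sub_lt_self 1 hm0) hS'
  exact ⟨L, L', L_pos, L'_pos, fun z => by simp only [hL z, neg_sq],
    h.periodic_sq_of_imaginary hs (h'.congr S'_eq) hS' (by push_cast; ring) hL'⟩

end IsSnGerm

section JacobiSn

variable (k : ℝ)

theorem analyticAt_incompleteEllipticIntegral_integrand :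
    AnalyticAt ℂ (fun θ => ((1 - (k : ℂ) ^ 2 * Complex.sin θ ^ 2) ^ (1 / 2 : ℂ))⁻¹) 0 := by
  have radicand : AnalyticAt ℂ (fun θ => 1 - (k : ℂ) ^ 2 * Complex.sin θ ^ 2) 0 := by fun_prop
  exact (radicand.cpow analyticAt_const (by simp)).inv (by simp)

theorem exists_isAnalyticLocalInverse_incompleteEllipticIntegral :
    ∃ am, IsAnalyticLocalInverse (incompleteEllipticIntegral k) am :=
  exists_isAnalyticLocalInverse_integralFromZero
    (analyticAt_incompleteEllipticIntegral_integrand k) (by simp)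

variable {k} {s : ℂ → ℂ}

theorem IsAnalyticLocalInverse.isSnGerm_sin {am : ℂ → ℂ}
    (h : IsAnalyticLocalInverse (incompleteEllipticIntegral k) am) :
    IsSnGerm ((k : ℂ) ^ 2) fun z => Complex.sin (am z) := by
  refine .of_hasDerivAt (s' := fun z => Complex.cos (am z) *
      (1 - (k : ℂ) ^ 2 * Complex.sin (am z) ^ 2) ^ (1 / 2 : ℂ))
    ?_ (by simp [h.map_zero]) (by simp [h.map_zero]) ?_
  · filter_upwards [h.eventually_hasDerivAt (eventually_hasDerivAt_integralFromZero
      (analyticAt_incompleteEllipticIntegral_integrand k))] with z hz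
    rw [inv_inv] at hz
    exact hz.csin
  · refine .of_forall fun z => ?_
    rw [mul_pow, sq_cpow_half, Complex.cos_sq']

theorem IsJacobiSn.isSnGerm (h : IsJacobiSn k s) : IsSnGerm ((k : ℂ) ^ 2) s :=
  let ⟨_, _, ham, s_eq⟩ := h
  ham.isSnGerm_sin.congr s_eq

variable (k) in
theorem existsUnique_isJacobiSn : ∃! s, IsJacobiSn k s := by
  obtain ⟨am, ham⟩ := exists_isAnalyticLocalInverse_incompleteEllipticIntegral k
  obtain ⟨s, hs, s_eq⟩ := ham.isSnGerm_sin.exists_isMeromorphicOnPlane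
  refine ⟨s, ⟨hs, am, ham, s_eq⟩, fun t ht => ht.1.eq_of_eventuallyEq (z := 0) hs ?_⟩
  exact (ht.isSnGerm.eventuallyEq (ham.isSnGerm_sin.congr s_eq)).filter_mono nhdsWithin_le_nhds

theorem isJacobiSn_jacobiSn (k : ℝ) : IsJacobiSn k (jacobiSn k) :=
  Classical.epsilon_spec (existsUnique_isJacobiSn k).exists

theorem IsJacobiSn.exists_periods_sq (h : IsJacobiSn k s) (hk0 : 0 < k) (hk1 : k < 1) :
    ∃ L L' : ℝ, 0 < L ∧ 0 < L' ∧ Function.Periodic (fun z => s z ^ 2) L ∧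
      Function.Periodic (fun z => s z ^ 2) (Complex.I * L') := by
  have germ : IsSnGerm ((k ^ 2 : ℝ) : ℂ) s := by exact_mod_cast h.isSnGerm
  have sq_lt_one : k ^ 2 < 1 := pow_lt_one₀ hk0.le hk1 two_ne_zero
  have complementary_germ := (isJacobiSn_jacobiSn √(1 - k ^ 2)).isSnGerm
  rw [← Complex.ofReal_pow, Real.sq_sqrt (sub_nonneg.2 sq_lt_one.le)] at complementary_germ
  exact germ.exists_periods_sq (by positivity) sq_lt_one complementary_germ h.1

end JacobiSn

theorem ascPochhammer_eval_two_mul {R : Type*} [CommSemiring R] {a b : R}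
    (hab : 2 * b = 2 * a + 1) (n : ℕ) :
    (ascPochhammer R (2 * n)).eval (2 * a) =
      4 ^ n * ((ascPochhammer R n).eval a * (ascPochhammer R n).eval b) := by
  induction n with
  | zero => simp
  | succ n ih =>
    have odd_factor : 2 * a + ((2 * n + 1 : ℕ) : R) = 2 * (b + n) := by
      push_cast
      rw [mul_add, hab]
      ring
    rw [show 2 * (n + 1) = 2 * n + 1 + 1 by ring, ascPochhammer_succ_eval,
      ascPochhammer_succ_eval, ih, odd_factor, ascPochhammer_succ_eval, ascPochhammer_succ_eval]
    push_cast
    ring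

theorem inv_factorial_mul_ascPochhammer_eval_two_mul {K : Type*} [Field K] [CharZero K]
    (a : K) (n : ℕ) :
    ((2 * n).factorial : K)⁻¹ * (ascPochhammer K (2 * n)).eval (2 * a) =
      ordinaryHypergeometricCoefficient a (a + 1 / 2) (1 / 2) n := by
  have factorial_eq : ((2 * n).factorial : K) =
      4 ^ n * ((ascPochhammer K n).eval (1 / 2) * n.factorial) := by
    rw [← ascPochhammer_eval_one K (2 * n), ← ascPochhammer_eval_one K n,
      ← ascPochhammer_eval_two_mul (by norm_num) n]
    norm_num
  have four_pow_ne_zero : (4 : K) ^ n ≠ 0 := pow_ne_zero n (by norm_num)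
  rw [factorial_eq, ascPochhammer_eval_two_mul (b := a + 1 / 2) (by ring),
    ordinaryHypergeometricCoefficient, mul_inv, mul_mul_mul_comm,
    inv_mul_cancel₀ four_pow_ne_zero, mul_inv]
  ring

theorem hasSum_one_sub_cpow_neg (a : ℂ) {x : ℂ} (hx : ‖x‖ < 1) :
    HasSum (fun n : ℕ => (n.factorial : ℂ)⁻¹ * (ascPochhammer ℂ n).eval a * x ^ n)
      ((1 - x) ^ (-a)) := by
  have sum_choose := (Complex.one_div_one_sub_cpow_hasFPowerSeriesOnBall_zero a).hasSum (y := x)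
    (by rw [← ENNReal.ofReal_one, Metric.eball_ofReal]; simpa using hx)
  have choose_eq (n : ℕ) :
      Ring.choose (a + n - 1) n = (n.factorial : ℂ)⁻¹ * (ascPochhammer ℂ n).eval a := by
    rw [eq_inv_mul_iff_mul_eq₀ (Nat.cast_ne_zero.2 n.factorial_ne_zero), ← nsmul_eq_mul,
      Ring.choose, show a + n - 1 - n + 1 = a by ring,
      Ring.factorial_nsmul_multichoose_eq_ascPochhammer,
      Polynomial.ascPochhammer_smeval_eq_eval]
  simpa [FormalMultilinearSeries.ofScalars_apply_eq, choose_eq, Complex.cpow_neg,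
    mul_comm (x ^ _)] using sum_choose

theorem two_mul_ordinaryHypergeometric_sq (a : ℂ) {x : ℂ} (hx : ‖x‖ < 1) :
    2 * ordinaryHypergeometric a (a + 1 / 2) (1 / 2 : ℂ) (x ^ 2) =
      (1 - x) ^ (-(2 * a)) + (1 + x) ^ (-(2 * a)) := by
  have sum_both := (hasSum_one_sub_cpow_neg (2 * a) hx).add
    (hasSum_one_sub_cpow_neg (2 * a) (x := -x) (by simpa using hx))
  rw [sub_neg_eq_add] at sum_both
  have two_mul_injective : Function.Injective fun n : ℕ => 2 * n :=
    mul_right_injective₀ two_ne_zero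
  have odd_term_eq_zero (n : ℕ) (hn : n ∉ Set.range fun n : ℕ => 2 * n) :
      (n.factorial : ℂ)⁻¹ * (ascPochhammer ℂ n).eval (2 * a) * x ^ n +
        (n.factorial : ℂ)⁻¹ * (ascPochhammer ℂ n).eval (2 * a) * (-x) ^ n = 0 := by
    have n_odd : Odd n := by
      rw [← Nat.not_even_iff_odd, even_iff_exists_two_mul]
      exact fun ⟨k, hk⟩ => hn ⟨k, hk.symm⟩
    rw [n_odd.neg_pow]
    ring
  rw [← two_mul_injective.hasSum_iff odd_term_eq_zero] at sum_both
  rw [ordinaryHypergeometric_eq_tsum, ← tsum_mul_left, ← sum_both.tsum_eq]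
  refine tsum_congr fun n => ?_
  simp only [Function.comp_apply, smul_eq_mul, (even_two_mul n).neg_pow, ← two_mul,
    inv_factorial_mul_ascPochhammer_eval_two_mul, ← pow_mul, ordinaryHypergeometricCoefficient]

theorem analyticAt_ordinaryHypergeometric (a b c : ℂ) :
    AnalyticAt ℂ (ordinaryHypergeometric a b c : ℂ → ℂ) 0 := by
  suffices radius_pos : 0 < (ordinaryHypergeometricSeries ℂ a b c).radius from
    (FormalMultilinearSeries.hasFPowerSeriesOnBall _ radius_pos).analyticAt
  by_cases h : ∀ n : ℕ, (n : ℂ) ≠ -a ∧ (n : ℂ) ≠ -b ∧ (n : ℂ) ≠ -c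
  · rw [ordinaryHypergeometricSeries_radius_eq_one ℂ a b c h]
    exact one_pos
  · suffices radius_top : (ordinaryHypergeometricSeries ℂ a b c).radius = ⊤ by simp [radius_top]
    simp only [not_forall, not_and_or, not_not, eq_neg_iff_add_eq_zero,
      add_eq_zero_iff_neg_eq] at h
    obtain ⟨n, rfl | rfl | rfl⟩ := h
    · exact ordinaryHypergeometric_radius_top_of_neg_nat₁ ℂ b c
    · exact ordinaryHypergeometric_radius_top_of_neg_nat₂ ℂ a c
    · exact ordinaryHypergeometric_radius_top_of_neg_nat₃ ℂ a b

theorem ordinaryHypergeometric_sin_sq {w : ℂ} (hw : ‖Complex.sin w‖ < 1)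
    (sub_pos : 0 < (Complex.cos (w / 2) - Complex.sin (w / 2)).re)
    (add_pos : 0 < (Complex.cos (w / 2) + Complex.sin (w / 2)).re) :
    ordinaryHypergeometric (1 / 4 : ℂ) (3 / 4 : ℂ) (1 / 2 : ℂ) (Complex.sin w ^ 2) =
      Complex.cos (w / 2) / Complex.cos w := by
  obtain ⟨v, rfl⟩ : ∃ v, w = 2 * v := ⟨w / 2, by ring⟩
  rw [mul_div_cancel_left₀ v two_ne_zero] at sub_pos add_pos ⊢
  have sub_sq : 1 - Complex.sin (2 * v) = (Complex.cos v - Complex.sin v) ^ 2 := by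
    rw [Complex.sin_two_mul]
    linear_combination -Complex.sin_sq_add_cos_sq v
  have add_sq : 1 + Complex.sin (2 * v) = (Complex.cos v + Complex.sin v) ^ 2 := by
    rw [Complex.sin_two_mul]
    linear_combination -Complex.sin_sq_add_cos_sq v
  have cos_eq : Complex.cos (2 * v) =
      (Complex.cos v - Complex.sin v) * (Complex.cos v + Complex.sin v) := by
    rw [Complex.cos_two_mul']
    ring
  have sq_cpow {x : ℂ} (hx : 0 < x.re) : (x ^ 2) ^ (-(2 * (1 / 4)) : ℂ) = x⁻¹ := by
    rw [Complex.cpow_neg, show (2 * (1 / 4) : ℂ) = 2⁻¹ by norm_num, Complex.sq_cpow_two_inv hx]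
  have two_mul_eq := two_mul_ordinaryHypergeometric_sq (1 / 4) hw
  rw [sub_sq, add_sq, sq_cpow sub_pos, sq_cpow add_pos,
    show (1 / 4 + 1 / 2 : ℂ) = 3 / 4 by norm_num] at two_mul_eq
  have sub_ne_zero : Complex.cos v - Complex.sin v ≠ 0 := fun h => by simp [h] at sub_pos
  have add_ne_zero : Complex.cos v + Complex.sin v ≠ 0 := fun h => by simp [h] at add_pos
  rw [cos_eq]
  field_simp at two_mul_eq ⊢
  linear_combination two_mul_eq / 2

theorem eventually_ordinaryHypergeometric_sin_sq : ∀ᶠ w in 𝓝 (0 : ℂ),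
    ordinaryHypergeometric (1 / 4 : ℂ) (3 / 4 : ℂ) (1 / 2 : ℂ) (Complex.sin w ^ 2) =
      Complex.cos (w / 2) / Complex.cos w := by
  have sin_cont : ContinuousAt (fun w : ℂ => ‖Complex.sin w‖) 0 := by fun_prop
  have sub_cont : ContinuousAt (fun w : ℂ => (Complex.cos (w / 2) - Complex.sin (w / 2)).re) 0 := by
    fun_prop
  have add_cont : ContinuousAt (fun w : ℂ => (Complex.cos (w / 2) + Complex.sin (w / 2)).re) 0 := by
    fun_prop
  filter_upwards [sin_cont.eventually_lt_const (u := 1) (by simp),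
    sub_cont.eventually_const_lt (u := 0) (by simp),
    add_cont.eventually_const_lt (u := 0) (by simp)] with w
  exact ordinaryHypergeometric_sin_sq

section Shen

variable (κ : ℝ)

theorem analyticAt_shenIntegral_integrand :
    AnalyticAt ℂ (fun t => ordinaryHypergeometric (1 / 4 : ℂ) (3 / 4 : ℂ) (1 / 2 : ℂ)
      ((κ : ℂ) ^ 2 * Complex.sin t ^ 2)) 0 :=
  (analyticAt_ordinaryHypergeometric _ _ _).comp_of_eq (by fun_prop) (by simp)

theorem exists_isAnalyticLocalInverse_shenIntegral :
    ∃ φ, IsAnalyticLocalInverse (shenIntegral κ) φ :=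
  exists_isAnalyticLocalInverse_integralFromZero (analyticAt_shenIntegral_integrand κ) (by simp)

end Shen

/-- The germs `φ` and `ψ` at `0` from which `dn₂ = cos ψ` of modulus `κ` is built: `φ` inverts
`shenIntegral κ`, and `sin ψ = κ sin φ` with `ψ(0) = 0`. -/
structure IsShenAmplitude (κ : ℝ) (φ ψ : ℂ → ℂ) : Prop where
  isAnalyticLocalInverse : IsAnalyticLocalInverse (shenIntegral κ) φ
  analyticAt : AnalyticAt ℂ ψ 0
  map_zero : ψ 0 = 0
  sin_eq : ∀ᶠ z in 𝓝 (0 : ℂ), Complex.sin (ψ z) = (κ : ℂ) * Complex.sin (φ z)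

theorem exists_isShenAmplitude (κ : ℝ) : ∃ φ ψ, IsShenAmplitude κ φ ψ := by
  obtain ⟨φ, hφ⟩ := exists_isAnalyticLocalInverse_shenIntegral κ
  obtain ⟨arcsin, h_arcsin⟩ := exists_isAnalyticLocalInverse (f := Complex.sin) (by fun_prop)
    Complex.sin_zero (by simp [Complex.deriv_sin])
  have φ_analytic := hφ.analyticAt
  have sin_analytic : AnalyticAt ℂ (fun z => (κ : ℂ) * Complex.sin (φ z)) 0 := by fun_prop
  have sin_tendsto : Tendsto (fun z => (κ : ℂ) * Complex.sin (φ z)) (𝓝 0) (𝓝 0) := by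
    simpa [hφ.map_zero] using sin_analytic.continuousAt.tendsto
  exact ⟨φ, fun z => arcsin (κ * Complex.sin (φ z)), hφ,
    h_arcsin.analyticAt.comp_of_eq sin_analytic (by simp [hφ.map_zero]),
    by simp [hφ.map_zero, h_arcsin.map_zero], sin_tendsto.eventually h_arcsin.right_inv⟩

namespace IsShenAmplitude

variable {κ : ℝ} {φ ψ : ℂ → ℂ}

theorem eventually_hasDerivAt_sin_half (h : IsShenAmplitude κ φ ψ) :
    ∀ᶠ z in 𝓝 (0 : ℂ),
      HasDerivAt (fun z => Complex.sin (ψ z / 2)) (κ / 2 * Complex.cos (φ z)) z := by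
  have ψ_cont := h.analyticAt.continuousAt
  have ψ_tendsto : Tendsto ψ (𝓝 0) (𝓝 0) := by simpa only [h.map_zero] using ψ_cont.tendsto
  have cos_half_cont : ContinuousAt (fun z => Complex.cos (ψ z / 2)) 0 := by fun_prop
  have cos_cont : ContinuousAt (fun z => Complex.cos (ψ z)) 0 := by fun_prop
  filter_upwards [h.isAnalyticLocalInverse.eventually_hasDerivAt
      (eventually_hasDerivAt_integralFromZero (analyticAt_shenIntegral_integrand κ)),
    h.sin_eq.eventually_nhds, ψ_tendsto.eventually eventually_ordinaryHypergeometric_sin_sq,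
    h.analyticAt.eventually_analyticAt, cos_half_cont.eventually_ne (y := 0) (by simp [h.map_zero]),
    cos_cont.eventually_ne (y := 0) (by simp [h.map_zero])]
    with z φ_deriv sin_eq hypergeometric_eq ψ_analytic cos_half_ne_zero cos_ne_zero
  rw [← mul_pow, ← sin_eq.self_of_nhds, hypergeometric_eq] at φ_deriv
  have ψ_deriv := ψ_analytic.differentiableAt.hasDerivAt
  have deriv_sin_eq : Complex.cos (ψ z) * deriv ψ z =
      κ * (Complex.cos (φ z) * (Complex.cos (ψ z / 2) / Complex.cos (ψ z))⁻¹) :=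
    ψ_deriv.csin.unique ((φ_deriv.csin.const_mul (κ : ℂ)).congr_of_eventuallyEq sin_eq)
  refine (ψ_deriv.div_const 2).csin.congr_deriv ?_
  field_simp at deriv_sin_eq ⊢
  exact deriv_sin_eq

/-- With `x = sin² (ψ/2)`, both sides of the differential equation of `sn` reduce to
`(1 - 2x / (1 - λ)) (1 - 2x / (1 + λ))`. -/
theorem isSnGerm (h : IsShenAmplitude κ φ ψ) {lam μ m : ℂ} (hκ0 : κ ≠ 0)
    (hκ : (κ : ℂ) ^ 2 = (1 - lam) * (1 + lam)) (hμ : 2 * μ ^ 2 = 1 + lam)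
    (hm : m * (1 + lam) = 1 - lam) :
    IsSnGerm m fun z => 2 * μ / κ * Complex.sin (ψ (z / μ) / 2) := by
  have κ_ne_zero : (κ : ℂ) ≠ 0 := Complex.ofReal_ne_zero.2 hκ0
  obtain ⟨sub_ne_zero, add_ne_zero⟩ : 1 - lam ≠ 0 ∧ 1 + lam ≠ 0 :=
    mul_ne_zero_iff.1 (hκ ▸ pow_ne_zero 2 κ_ne_zero)
  have μ_ne_zero : μ ≠ 0 := by
    rintro rfl
    exact add_ne_zero (by simpa using hμ.symm)
  have div_tendsto : Tendsto (fun z : ℂ => z / μ) (𝓝 0) (𝓝 0) :=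
    Continuous.tendsto' (by fun_prop) 0 0 (zero_div μ)
  refine .of_hasDerivAt (s' := fun z => Complex.cos (φ (z / μ))) ?_ (by simp [h.map_zero])
    (by simp [h.isAnalyticLocalInverse.map_zero]) ?_
  · filter_upwards [div_tendsto.eventually h.eventually_hasDerivAt_sin_half] with z hz
    refine ((hz.comp z ((hasDerivAt_id z).div_const μ)).const_mul (2 * μ / κ)).congr_deriv ?_
    field_simp
  · filter_upwards [div_tendsto.eventually h.sin_eq] with z sin_eq
    have sin_sq_eq : Complex.sin (ψ (z / μ)) ^ 2 =
        4 * Complex.sin (ψ (z / μ) / 2) ^ 2 * (1 - Complex.sin (ψ (z / μ) / 2) ^ 2) := by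
      have sin_two_mul := Complex.sin_two_mul (ψ (z / μ) / 2)
      rw [mul_div_cancel₀ _ two_ne_zero] at sin_two_mul
      rw [sin_two_mul, mul_pow, Complex.cos_sq']
      ring
    rw [sin_eq, mul_pow, Complex.sin_sq] at sin_sq_eq
    generalize Complex.sin (ψ (z / μ) / 2) = y at *
    have sq_eq : (2 * μ / κ * y) ^ 2 = 2 * y ^ 2 / (1 - lam) := by
      rw [mul_pow, div_pow, mul_pow, hκ]
      field_simp
      linear_combination y ^ 2 * hμ
    rw [sq_eq, eq_div_iff add_ne_zero |>.2 hm]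
    rw [hκ] at sin_sq_eq
    field_simp
    linear_combination -sin_sq_eq

theorem eventually_cos_eq (h : IsShenAmplitude κ φ ψ) {lam μ m : ℂ} {s : ℂ → ℂ} (hκ0 : κ ≠ 0)
    (hκ : (κ : ℂ) ^ 2 = (1 - lam) * (1 + lam)) (hμ : 2 * μ ^ 2 = 1 + lam)
    (hm : m * (1 + lam) = 1 - lam) (hs : IsSnGerm m s) :
    ∀ᶠ z in 𝓝 (0 : ℂ), Complex.cos (ψ z) = 1 - (1 - lam) * s (z * μ) ^ 2 := by
  have κ_ne_zero : (κ : ℂ) ≠ 0 := Complex.ofReal_ne_zero.2 hκ0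
  have μ_ne_zero : μ ≠ 0 := by
    rintro rfl
    exact pow_ne_zero 2 κ_ne_zero (by rw [hκ, ← hμ]; ring)
  have mul_tendsto : Tendsto (fun z : ℂ => z * μ) (𝓝 0) (𝓝 0) :=
    Continuous.tendsto' (by fun_prop) 0 0 (zero_mul μ)
  filter_upwards [mul_tendsto.eventually (hs.eventuallyEq (h.isSnGerm hκ0 hκ hμ hm))] with z hz
  have cos_eq : Complex.cos (ψ z) = 1 - 2 * Complex.sin (ψ z / 2) ^ 2 := by
    have cos_two_mul := Complex.cos_two_mul (ψ z / 2)
    rw [mul_div_cancel₀ (ψ z) two_ne_zero, Complex.cos_sq'] at cos_two_mul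
    linear_combination cos_two_mul
  rw [hz, mul_div_cancel_right₀ z μ_ne_zero, cos_eq]
  field_simp
  linear_combination (-2 * Complex.sin (ψ z / 2) ^ 2) * hκ +
    2 * (1 - lam) * Complex.sin (ψ z / 2) ^ 2 * hμ

end IsShenAmplitude

section Pole

variable {f g : ℂ → ℂ} {z : ℂ}

theorem hasPoleAt_congr (hfg : f =ᶠ[𝓝[≠] z] g) : HasPoleAt f z ↔ HasPoleAt g z := by
  rw [HasPoleAt, HasPoleAt, MeromorphicAt.meromorphicAt_congr hfg, meromorphicOrderAt_congr hfg]

theorem hasPoleAt_comp_iff (hg : AnalyticAt ℂ g z) (hg' : deriv g z ≠ 0) :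
    HasPoleAt (fun w => f (g w)) z ↔ HasPoleAt f (g z) :=
  and_congr (meromorphicAt_comp_iff_of_deriv_ne_zero hg hg')
    (by rw [← meromorphicOrderAt_comp_of_deriv_ne_zero hg hg', Function.comp_def])

theorem hasPoleAt_const_add_iff (hf : MeromorphicAt f z) (a : ℂ) :
    HasPoleAt (fun w => a + f w) z ↔ HasPoleAt f z := by
  have const_order : 0 ≤ meromorphicOrderAt (fun _ => a) z :=
    analyticAt_const.meromorphicOrderAt_nonneg
  refine ⟨fun h => ⟨hf, ?_⟩, fun h => ⟨(MeromorphicAt.const a z).add hf, ?_⟩⟩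
  · by_contra! f_order
    exact ((le_min const_order f_order).trans
      (meromorphicOrderAt_add (MeromorphicAt.const a z) hf)).not_gt h.2
  · exact (meromorphicOrderAt_add_eq_right_of_lt (MeromorphicAt.const a z)
      (h.2.trans_le const_order)).trans_lt h.2

theorem hasPoleAt_const_mul_sq_iff (hf : MeromorphicAt f z) {b : ℂ} (hb : b ≠ 0) :
    HasPoleAt (fun w => b * f w ^ 2) z ↔ HasPoleAt f z := by
  have order_eq : meromorphicOrderAt (fun w => b * f w ^ 2) z = (2 : ℕ) * meromorphicOrderAt f z :=
    (meromorphicOrderAt_mul_of_ne_zero analyticAt_const hb).trans (meromorphicOrderAt_pow hf)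
  have two_mul_neg_iff (n : WithTop ℤ) : (2 : ℕ) * n < 0 ↔ n < 0 := by
    cases n with
    | top => simp
    | coe n =>
      rw [← WithTop.coe_natCast, ← WithTop.coe_mul, ← WithTop.coe_zero, WithTop.coe_lt_coe,
        WithTop.coe_lt_coe]
      omega
  rw [HasPoleAt, HasPoleAt, order_eq, two_mul_neg_iff, and_iff_right hf, and_iff_right]
  exact (MeromorphicAt.const b z).mul (hf.pow 2)

theorem hasPoleAt_const_sub_const_mul_sq_iff (hf : MeromorphicAt f z) (a : ℂ) {b : ℂ}
    (hb : b ≠ 0) : HasPoleAt (fun w => a - b * f w ^ 2) z ↔ HasPoleAt f z := by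
  have sq_mero : MeromorphicAt (fun w => -b * f w ^ 2) z :=
    (MeromorphicAt.const (-b) z).mul (hf.pow 2)
  simpa only [sub_eq_add_neg, neg_mul] using (hasPoleAt_const_add_iff sq_mero a).trans
    (hasPoleAt_const_mul_sq_iff hf (neg_ne_zero.2 hb))

theorem IsMeromorphicOnPlane.analyticAt_of_not_hasPoleAt (hf : IsMeromorphicOnPlane f)
    (h : ¬HasPoleAt f z) : AnalyticAt ℂ f z := by
  rw [← (hf.meromorphicNFAt z).meromorphicOrderAt_nonneg_iff_analyticAt]
  exact not_lt.1 fun order_neg => h ⟨hf.meromorphic z, order_neg⟩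

end Pole

theorem linearIndependent_ofReal_I_mul {a b : ℝ} (ha : a ≠ 0) (hb : b ≠ 0) :
    LinearIndependent ℝ ![(a : ℂ), Complex.I * b] := by
  rw [LinearIndependent.pair_iff]
  intro x y h
  have h_re : x * a = 0 := by simpa using congrArg Complex.re h
  have h_im : y * b = 0 := by simpa using congrArg Complex.im h
  exact ⟨(mul_eq_zero.1 h_re).resolve_right ha, (mul_eq_zero.1 h_im).resolve_right hb⟩

section SnSq

variable {s d : ℂ → ℂ} {c μ z : ℂ}

theorem IsMeromorphicOnPlane.meromorphic_one_sub_mul_sq (hs : IsMeromorphicOnPlane s) (c μ : ℂ) :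
    Meromorphic fun z => 1 - c * s (z * μ) ^ 2 := fun z =>
  (MeromorphicAt.const 1 z).sub ((MeromorphicAt.const c z).mul
    (((hs.comp_analytic (g := (· * μ)) (by fun_prop)).meromorphic z).pow 2))

theorem IsMeromorphicOnPlane.hasPoleAt_iff_of_eventuallyEq (hs : IsMeromorphicOnPlane s)
    (hc : c ≠ 0) (hμ : μ ≠ 0) (h : d =ᶠ[𝓝[≠] z] fun w => 1 - c * s (w * μ) ^ 2) :
    HasPoleAt d z ↔ HasPoleAt s (z * μ) := by
  have scaled_mero := (hs.comp_analytic (g := (· * μ)) (by fun_prop)).meromorphic z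
  rw [hasPoleAt_congr h, hasPoleAt_const_sub_const_mul_sq_iff scaled_mero 1 hc,
    hasPoleAt_comp_iff (by fun_prop) (by simpa using hμ)]

theorem IsMeromorphicOnPlane.eq_of_eventuallyEq_of_not_hasPoleAt (hs : IsMeromorphicOnPlane s)
    (hd : IsMeromorphicOnPlane d) (hc : c ≠ 0) (hμ : μ ≠ 0)
    (h : d =ᶠ[𝓝[≠] z] fun w => 1 - c * s (w * μ) ^ 2) (hz : ¬HasPoleAt d z) :
    d z = 1 - c * s (z * μ) ^ 2 := by
  have s_analytic := hs.analyticAt_of_not_hasPoleAt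
    ((hs.hasPoleAt_iff_of_eventuallyEq hc hμ h).not.1 hz)
  have scaled_analytic : AnalyticAt ℂ (fun w => s (w * μ)) z :=
    s_analytic.fun_comp (f := (· * μ)) (by fun_prop)
  exact (((hd.meromorphicNFAt z).eventuallyEq_nhdsNE_iff_eventuallyEq_nhds
    (analyticAt_const.sub
      (analyticAt_const.mul (scaled_analytic.pow 2))).meromorphicNFAt).1 h).eq_of_nhds

end SnSq

section ShenDn

variable {κ k lam μ : ℝ} {s d : ℂ → ℂ}

theorem IsJacobiSn.exists_periods_one_sub_mul_sq (hs : IsJacobiSn k s) (hk0 : 0 < k) (hk1 : k < 1)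
    (hμ : μ ≠ 0) (c : ℂ) :
    ∃ ω₁ ω₂ : ℂ, LinearIndependent ℝ ![ω₁, ω₂] ∧
      Function.Periodic (fun z => 1 - c * s (z * μ) ^ 2) ω₁ ∧
      Function.Periodic (fun z => 1 - c * s (z * μ) ^ 2) ω₂ := by
  obtain ⟨L, L', hL, hL', real_period, imag_period⟩ := hs.exists_periods_sq hk0 hk1
  have μ_ne_zero : (μ : ℂ) ≠ 0 := Complex.ofReal_ne_zero.2 hμ
  have period_of_sq {ω : ℂ} (hω : Function.Periodic (fun z => s z ^ 2) (ω * μ)) :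
      Function.Periodic (fun z => 1 - c * s (z * μ) ^ 2) ω := fun z => by
    simpa only [add_mul] using congrArg (1 - c * ·) (hω (z * μ))
  refine ⟨(L / μ : ℝ), Complex.I * (L' / μ : ℝ),
    linearIndependent_ofReal_I_mul (div_ne_zero hL.ne' hμ) (div_ne_zero hL'.ne' hμ),
    period_of_sq ?_, period_of_sq ?_⟩
  · rwa [Complex.ofReal_div, div_mul_cancel₀ _ μ_ne_zero]
  · rwa [Complex.ofReal_div, mul_assoc, div_mul_cancel₀ _ μ_ne_zero]

theorem IsShenAmplitude.eventually_cos_eq_of_isJacobiSn {φ ψ : ℂ → ℂ} (h : IsShenAmplitude κ φ ψ)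
    (hκ0 : κ ≠ 0) (hκ : κ ^ 2 = (1 - lam) * (1 + lam)) (hμ : 2 * μ ^ 2 = 1 + lam)
    (hk : k ^ 2 * (1 + lam) = 1 - lam) (hs : IsJacobiSn k s) :
    ∀ᶠ z in 𝓝 (0 : ℂ), Complex.cos (ψ z) = 1 - (1 - (lam : ℂ)) * s (z * μ) ^ 2 :=
  h.eventually_cos_eq hκ0 (by exact_mod_cast congrArg Complex.ofReal hκ)
    (by exact_mod_cast congrArg Complex.ofReal hμ) (by exact_mod_cast congrArg Complex.ofReal hk)
    hs.isSnGerm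

theorem IsShenDn2.eventuallyEq_nhdsNE (hd : IsShenDn2 κ d)
    (hκ0 : κ ≠ 0) (hκ : κ ^ 2 = (1 - lam) * (1 + lam)) (hμ : 2 * μ ^ 2 = 1 + lam)
    (hk : k ^ 2 * (1 + lam) = 1 - lam) (hs : IsJacobiSn k s) (z : ℂ) :
    d =ᶠ[𝓝[≠] z] fun w => 1 - (1 - (lam : ℂ)) * s (w * μ) ^ 2 := by
  obtain ⟨⟨hd_mero, -⟩, φ, ψ, hφ, hψ, hψ0, hsin, d_eq⟩ := hd
  have cos_eq :=
    IsShenAmplitude.eventually_cos_eq_of_isJacobiSn ⟨hφ, hψ, hψ0, hsin⟩ hκ0 hκ hμ hk hs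
  exact eventuallyEq_nhdsNE_of_meromorphic (IsMeromorphicOnPlane.meromorphic hd_mero)
    (hs.1.meromorphic_one_sub_mul_sq _ μ)
    ((EventuallyEq.trans d_eq cos_eq).filter_mono nhdsWithin_le_nhds) z

theorem exists_isShenDn2 (hκ0 : κ ≠ 0) (hκ : κ ^ 2 = (1 - lam) * (1 + lam))
    (hμ : 2 * μ ^ 2 = 1 + lam) (hk : k ^ 2 * (1 + lam) = 1 - lam) (hk0 : 0 < k) (hk1 : k < 1) :
    ∃ d, IsShenDn2 κ d := by
  have μ_ne_zero : μ ≠ 0 := by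
    rintro rfl
    exact pow_ne_zero 2 hκ0 (by rw [hκ, ← hμ]; ring)
  have hs := isJacobiSn_jacobiSn k
  obtain ⟨φ, ψ, h⟩ := exists_isShenAmplitude κ
  have G_mero := hs.1.meromorphic_one_sub_mul_sq (1 - lam) μ
  obtain ⟨ω₁, ω₂, independent, period₁, period₂⟩ :=
    hs.exists_periods_one_sub_mul_sq hk0 hk1 μ_ne_zero (1 - lam)
  set G : ℂ → ℂ := fun z => 1 - (1 - (lam : ℂ)) * jacobiSn k (z * μ) ^ 2
  have nf_mero : IsMeromorphicOnPlane (toMeromorphicNFOn G Set.univ) :=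
    meromorphicNFOn_toMeromorphicNFOn _ _
  have nf_eq (z : ℂ) : toMeromorphicNFOn G Set.univ =ᶠ[𝓝[≠] z] G :=
    G_mero.meromorphicOn.toMeromorphicNFOn_eq_self_on_nhdsNE (Set.mem_univ z)
  have cos_analytic : AnalyticAt ℂ (fun z => Complex.cos (ψ z)) 0 := by
    have := h.analyticAt
    fun_prop
  have cos_eq : G =ᶠ[𝓝 0] fun z => Complex.cos (ψ z) :=
    EventuallyEq.symm (h.eventually_cos_eq_of_isJacobiSn hκ0 hκ hμ hk hs)
  exact ⟨_, ⟨nf_mero, ω₁, ω₂, independent, nf_mero.periodic_of_eventuallyEq nf_eq period₁,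
      nf_mero.periodic_of_eventuallyEq nf_eq period₂⟩,
    φ, ψ, h.isAnalyticLocalInverse, h.analyticAt, h.map_zero, h.sin_eq,
    ((nf_mero.meromorphicNFAt 0).eventuallyEq_nhdsNE_iff_eventuallyEq_nhds
      cos_analytic.meromorphicNFAt).1
      ((nf_eq 0).trans (cos_eq.filter_mono nhdsWithin_le_nhds))⟩

theorem existsUnique_isShenDn2 (hκ0 : κ ≠ 0) (hκ : κ ^ 2 = (1 - lam) * (1 + lam))
    (hμ : 2 * μ ^ 2 = 1 + lam) (hk : k ^ 2 * (1 + lam) = 1 - lam) (hk0 : 0 < k) (hk1 : k < 1) :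
    ∃! d, IsShenDn2 κ d := by
  have eq_near_zero {d : ℂ → ℂ} (hd : IsShenDn2 κ d) :=
    hd.eventuallyEq_nhdsNE hκ0 hκ hμ hk (isJacobiSn_jacobiSn k) 0
  exact existsUnique_of_exists_of_unique (exists_isShenDn2 hκ0 hκ hμ hk hk0 hk1)
    fun d e hd he => IsMeromorphicOnPlane.eq_of_eventuallyEq hd.1.1 he.1.1
      ((eq_near_zero hd).trans (eq_near_zero he).symm)

end ShenDn

theorem modulus_relations {κ lam k : ℝ} (hκ0 : 0 < κ) (hκ1 : κ < 1)
    (hlam : lam = Real.sqrt (1 - κ ^ 2)) (hk : k ^ 2 = (1 - lam) / (1 + lam)) :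
    κ ^ 2 = (1 - lam) * (1 + lam) ∧ 2 * Real.sqrt ((1 + lam) / 2) ^ 2 = 1 + lam ∧
      k ^ 2 * (1 + lam) = 1 - lam ∧ k < 1 ∧ lam < 1 ∧ 0 < Real.sqrt ((1 + lam) / 2) := by
  have lam_sq : lam ^ 2 = 1 - κ ^ 2 := by rw [hlam, Real.sq_sqrt (by nlinarith)]
  have lam_pos : 0 < lam := hlam ▸ Real.sqrt_pos.2 (by nlinarith)
  have k_sq : k ^ 2 * (1 + lam) = 1 - lam := (eq_div_iff (by positivity)).1 hk
  have k_lt_one : k < 1 := lt_of_pow_lt_pow_left₀ 2 zero_le_one (by nlinarith)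
  refine ⟨by linear_combination lam_sq, ?_, k_sq, k_lt_one, by nlinarith, by positivity⟩
  rw [Real.sq_sqrt (by positivity)]
  ring

theorem mainTheorem7 (κ lam k : ℝ) (hκ0 : 0 < κ) (hκ1 : κ < 1)
    (hlam : lam = Real.sqrt (1 - κ ^ 2))
    (hk0 : 0 < k) (hk : k ^ 2 = (1 - lam) / (1 + lam)) :
    (∃! d : ℂ → ℂ, IsShenDn2 κ d) ∧
    (∃! s : ℂ → ℂ, IsJacobiSn k s) ∧
    IsShenDn2 κ (shenDn2 κ) ∧
    IsJacobiSn k (jacobiSn k) ∧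
    ∀ z : ℂ,
      (HasPoleAt (shenDn2 κ) z ↔
        HasPoleAt (jacobiSn k) (z * (Real.sqrt ((1 + lam) / 2) : ℂ))) ∧
      (¬ HasPoleAt (shenDn2 κ) z →
        shenDn2 κ z =
          1 - (1 - (lam : ℂ)) * jacobiSn k (z * (Real.sqrt ((1 + lam) / 2) : ℂ)) ^ 2) := by
  obtain ⟨hκ, hμ, hk', hk1, hlam1, hμ0⟩ := modulus_relations hκ0 hκ1 hlam hk
  have one_sub_lam_ne_zero : 1 - (lam : ℂ) ≠ 0 := sub_ne_zero.2 (by exact_mod_cast hlam1.ne')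
  have scale_ne_zero := Complex.ofReal_ne_zero.2 hμ0.ne'
  have sn := isJacobiSn_jacobiSn k
  have existsUnique_dn := existsUnique_isShenDn2 hκ0.ne' hκ hμ hk' hk0 hk1
  have dn : IsShenDn2 κ (shenDn2 κ) := Classical.epsilon_spec existsUnique_dn.exists
  have sn_mero : IsMeromorphicOnPlane (jacobiSn k) := sn.1
  refine ⟨existsUnique_dn, existsUnique_isJacobiSn k, dn, sn, fun z => ?_⟩
  have dn_eq := dn.eventuallyEq_nhdsNE hκ0.ne' hκ hμ hk' sn z
  exact ⟨sn_mero.hasPoleAt_iff_of_eventuallyEq one_sub_lam_ne_zero scale_ne_zero dn_eq,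
    sn_mero.eq_of_eventuallyEq_of_not_hasPoleAt dn.1.1 one_sub_lam_ne_zero scale_ne_zero dn_eq⟩
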